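/- **Setting.** Let $T\ge 1$. For $t=1,\dots,T$ let $\mathcal M_t=\langle \mathcal S_t,\mathcal A_t,\mathcal P_t,\mathcal R_t,\gamma_t\rangle$ be a Markov decision process with measurable state and action spaces, transition kernel $\mathcal P_t(\cdot\mid s,a)$, measurable reward function $\mathcal R_t(s,a,s')$ with $|\mathcal R_t|\le R_{\max,t}$, and discount factor $\gamma_t\in(0,1)$; let $\rho_t,\nu_t$ be probability measures on $\mathcal S_t\times\mathcal A_t$ (when the tasks share their spaces one may take $\rho_t=\rho$, $\nu_t=\nu$). A policy is a measurable map $\pi:\mathcal S_t\to\mathcal A_t$. Write $Q_t^{\pi}(s,a)=\mathbb E\big[\sum_{k\ge 0}\gamma_t^k\,\mathcal R_t(s_k,a_k,s_{k+1})\,\big|\,s_0=s,a_0=a\big]$, where $s_{k+1}\sim\mathcal P_t(\cdot\mid s_k,a_k)$ and $a_{k+1}=\pi(s_{k+1})$; let $P_t^{\pi}$ be the transition kernel on $\mathcal S_t\times\mathcal A_t$ sending $(s,a)$ to the law of $(s',\pi(s'))$, $s'\sim \mathcal P_t(\cdot\mid s,a)$; and let $(\mathcal T_t^*Q)(s,a)=\int\big[\mathcal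 R_t(s,a,s')+\gamma_t\max_{a'}Q(s',a')\big]\,\mathcal P_t(ds'\mid s,a)$. Let $Q_t^*$ be the bounded measurable solution of $Q_t^*=\mathcal T_t^*Q_t^*$ (with $s\mapsto\max_aQ_t^*(s,a)$ measurable), and $\pi_t^*$ an optimal policy, i.e. $Q_t^{\pi_t^*}=Q_t^*$. For policies $\pi_1,\dots,\pi_n$ of task $t$ let $c_t(\pi_1,\dots,\pi_n)=\Big(\int\big|\tfrac{d(\rho_tP_t^{\pi_1}\cdots P_t^{\pi_n})}{d\nu_t}\big|^2d\nu_t\Big)^{1/2}$, and $c_t=\infty$ if $\rho_tP_t^{\pi_1}\cdots P_t^{\pi_n}\not\ll\nu_t$. Let $c_{\mathrm{VI}_1,t}(m_1,m_2;\pi)$ be the coefficient of $\rho_t(P_t^{\pi})^{m_1}(P_t^{\pi_t^*})^{m_2}$ and $c_{\mathrm{VI}_2,t}(m;\pi_{k+1},\dots,\pi_K)$ that of $\rho_t(P_t^{\pi_K})^{m}P_t^{\pi_{K-1}}P_t^{\pi_{K-2}}\cdots P_t^{\pi_{k+1}}$. For $\beta\in(0,1)$ put $\alpha_k(\beta)=\frac{(1-\beta)\beta^{K-k-1}}{1-\beta^{K+1}}$,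 $0\le k<K$, and $$C_{\mathrm{VI}}(K;t,r)=\Big(\frac{1-\gamma_t}{2}\Big)^2\sup_{\pi'_1,\dots,\pi'_K}\sum_{k=0}^{K-1}\alpha_k(\gamma_t)^{2(1-r)}\Big[\sum_{m\ge0}\gamma_t^m\big(c_{\mathrm{VI}_1,t}(m,K-k;\pi'_K)+c_{\mathrm{VI}_2,t}(m+1;\pi'_{k+1},\dots,\pi'_K)\big)\Big]^2\in[0,\infty].$$ **Theorem.** Let $K$ be a positive integer, $\gamma=\max_t\gamma_t$, and $Q_{\max,t}\le\frac{R_{\max,t}}{1-\gamma}$ for every $t$. For every $t$ let $(Q_{t,k})_{k=0}^{K}$ be measurable functions on $\mathcal S_t\times\mathcal A_t$ bounded by $Q_{\max,t}$, and let $\pi_{t,k}$ be a (measurable) greedy policy with respect to $Q_{t,k}$, $0\le k\le K$ (such policies always exist if $\mathcal A_t$ is finite). Put $\varepsilon_{\mathrm{avg},k}=\frac1T\sum_{t=1}^T\|Q_{t,k+1}-\mathcal T_t^*Q_{t,k}\|_{2,\nu_t}^2$ for $0\le k<K$. Then $$\frac1T\sum_{t=1}^T\big\|Q_t^*-Q_t^{\pi_{t,K}}\big\|_{1,\rho_t}\le\frac{2\gamma}{(1-\gamma)^2}\left[\inf_{r\in[0,1]}C_{\mathrm{VI}}^{1/2}(K;r)\,\mathcal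 E_{\mathrm{avg}}^{1/2}(r)+\frac{2\gamma^KR_{\max,\mathrm{avg}}}{1-\gamma}\right],$$ where $C_{\mathrm{VI}}^{1/2}(K;r)=\max_tC_{\mathrm{VI}}^{1/2}(K;t,r)$, $\mathcal E_{\mathrm{avg}}(r)=\sum_{k=0}^{K-1}\alpha_k(\gamma)^{2r}\varepsilon_{\mathrm{avg},k}$, $R_{\max,\mathrm{avg}}=\frac1T\sum_tR_{\max,t}$, and the product $C_{\mathrm{VI}}^{1/2}\mathcal E_{\mathrm{avg}}^{1/2}$ is read as $+\infty$ whenever $C_{\mathrm{VI}}=\infty$. -/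

import Mathlib

open MeasureTheory ProbabilityTheory
open scoped ENNReal

/-- A Markov decision process on the state space `S` and the action space `A`: transition kernel
`P (· | s, a)`, reward function `R (s, a, s')` and discount factor `γ ∈ (0, 1]`. -/
structure MDP (S A : Type*) [MeasurableSpace S] [MeasurableSpace A] where
  P : Kernel (S × A) S
  markov : IsMarkovKernel P
  R : S × A × S → ℝ
  measurable_R : Measurable R
  γ : ℝ
  γ_pos : 0 < γ
  γ_le_one : γ ≤ 1

/-- Deterministic stationary (measurable) policies. -/
abbrev Policy (S A : Type*) [MeasurableSpace S] [MeasurableSpace A] :=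
  {π : S → A // Measurable π}

/-- `f ∈ B(X, L)`: measurable and bounded by `L` in absolute value. -/
def MemB {X : Type*} [MeasurableSpace X] (f : X → ℝ) (L : ℝ) : Prop :=
  Measurable f ∧ ∀ x, |f x| ≤ L

/-- `π` is greedy with respect to `Q`: `π s` attains `max_a Q (s, a)` at every state. -/
def IsGreedy {S A : Type*} [MeasurableSpace S] [MeasurableSpace A]
    (π : Policy S A) (Q : S × A → ℝ) : Prop :=
  ∀ s a, Q (s, a) ≤ Q (s, π.1 s)

/-- The weights `α_k`, `0 ≤ k ≤ K`, for the discount factor `γ`. -/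
noncomputable def avgWeight (γ : ℝ) (K k : ℕ) : ℝ :=
  if k < K then (1 - γ) * γ ^ (K - k - 1) / (1 - γ ^ (K + 1))
  else (1 - γ) * γ ^ K / (1 - γ ^ (K + 1))

/-- Product of a concentrability coefficient `c` and an error `e`, with the convention that an
infinite coefficient always gives an infinite (void) bound, also when `e = 0`. -/
noncomputable def coeffMul (c e : ℝ≥0∞) : ℝ≥0∞ :=
  if c = ∞ then ∞ else c * e

namespace MDP

variable {S A : Type*} [MeasurableSpace S] [MeasurableSpace A]

/-- The kernel `P^π` on state-action pairs: `(s, a) ↦` law of `(s', π s')`, `s' ∼ P (· | s, a)`. -/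
noncomputable def policyKernel (M : MDP S A) (π : Policy S A) : Kernel (S × A) (S × A) :=
  M.P.map (fun s' => (s', π.1 s'))

instance (M : MDP S A) (π : Policy S A) : IsMarkovKernel (M.policyKernel π) :=
  haveI := M.markov
  Kernel.IsMarkovKernel.map M.P (measurable_id.prodMk π.2)

/-- The law of the trajectory `(s_n, a_n)_{n ≥ 0}` with `(s_0, a_0) = z`, `s_{n+1} ∼ P (· | s_n, a_n)`
and `a_{n+1} = π s_{n+1}`. -/
noncomputable def trajLaw (M : MDP S A) (π : Policy S A) (z : S × A) : Measure (ℕ → S × A) :=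
  Kernel.traj (X := fun _ => S × A)
    (fun n => (M.policyKernel π).comap
      (fun h : (i : Finset.Iic n) → S × A => h ⟨n, Finset.mem_Iic.2 le_rfl⟩)
      (measurable_pi_apply _)) 0 (fun _ => z)

/-- The action-value function `Q^π`: expected discounted cumulative reward when starting from the
given state-action pair and following `π` thereafter. -/
noncomputable def actionValue (M : MDP S A) (π : Policy S A) (z : S × A) : ℝ :=
  ∫ ω, ∑' k : ℕ, M.γ ^ k * M.R ((ω k).1, (ω k).2, (ω (k + 1)).1) ∂(M.trajLaw π z)

/-- The optimal Bellman operator `T^*`. -/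
noncomputable def bellmanOpt (M : MDP S A) (Q : S × A → ℝ) (z : S × A) : ℝ :=
  ∫ s', (M.R (z.1, z.2, s') + M.γ * ⨆ a', Q (s', a')) ∂(M.P z)

/-- `Q` is the optimal action-value function: the bounded measurable solution of the Bellman
optimality equation. Measurability of `s ↦ max_a Q (s, a)` (automatic for finitely many actions)
makes the integral in the equation meaningful. -/
def IsOptimalActionValue (M : MDP S A) (Q : S × A → ℝ) : Prop :=
  (∃ L, MemB Q L) ∧ Measurable (fun s => ⨆ a, Q (s, a)) ∧ M.bellmanOpt Q = Q

/-- `futureLaw ρ [π₁, …, π_m] = ρ P^{π₁} ⋯ P^{π_m}`. -/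
noncomputable def futureLaw (M : MDP S A) (ρ : Measure (S × A)) (l : List (Policy S A)) :
    Measure (S × A) :=
  l.foldl (fun μ π => μ.bind (M.policyKernel π)) ρ

open Classical in
/-- `(E_ν |d(ρ P^{π₁} ⋯ P^{π_m}) / dν|²)^{1/2}`, and `∞` without absolute continuity. -/
noncomputable def concentrability (M : MDP S A) (ρ ν : Measure (S × A)) (l : List (Policy S A)) :
    ℝ≥0∞ :=
  if M.futureLaw ρ l ≪ ν then
    (∫⁻ z, ((M.futureLaw ρ l).rnDeriv ν z) ^ 2 ∂ν) ^ (1 / 2 : ℝ)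
  else ∞

/-- `c_{VI₁,ρ,ν}(m₁, m₂; π)`, the coefficient of `ρ (P^π)^{m₁} (P^{π*})^{m₂}`. -/
noncomputable def cVI1 (M : MDP S A) (ρ ν : Measure (S × A)) (πstar : Policy S A) (m₁ m₂ : ℕ)
    (π : Policy S A) : ℝ≥0∞ :=
  M.concentrability ρ ν (List.replicate m₁ π ++ List.replicate m₂ πstar)

/-- `c_{VI₂,ρ,ν}(m; π_{k+1}, …, π_K)`, the coefficient of
`ρ (P^{π_K})^m P^{π_{K-1}} P^{π_{K-2}} ⋯ P^{π_{k+1}}`. -/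
noncomputable def cVI2 (M : MDP S A) (ρ ν : Measure (S × A)) (m k K : ℕ) (π : ℕ → Policy S A) :
    ℝ≥0∞ :=
  M.concentrability ρ ν
    (List.replicate m (π K) ++ (List.range (K - 1 - k)).map (fun i => π (K - 1 - i)))

/-- `C_{VI,ρ,ν}(K; r)`. Only the entries `π' 1, …, π' K` of the sequence `π'` matter. -/
noncomputable def CVI (M : MDP S A) (ρ ν : Measure (S × A)) (πstar : Policy S A) (K : ℕ) (r : ℝ) :
    ℝ≥0∞ :=
  ENNReal.ofReal (((1 - M.γ) / 2) ^ 2) *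
    ⨆ π' : ℕ → Policy S A, ∑ k ∈ Finset.range K,
      ENNReal.ofReal (avgWeight M.γ K k ^ (2 * (1 - r))) *
        (∑' m : ℕ, ENNReal.ofReal (M.γ ^ m) *
          (M.cVI1 ρ ν πstar m (K - k) (π' K) + M.cVI2 ρ ν (m + 1) k K π')) ^ 2

end MDP

section MultiTask

variable {T : ℕ} {S A : Fin T → Type*} [∀ t, MeasurableSpace (S t)] [∀ t, MeasurableSpace (A t)]

/-- `γ = max_t γ_t`. -/
noncomputable def maxDiscount (M : ∀ t, MDP (S t) (A t)) : ℝ :=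
  ⨆ t, (M t).γ

/-- `ε_{avg,k} = (1/T) ∑_t ‖Q_{t,k+1} - T_t^* Q_{t,k}‖²_{2,ν_t}`. -/
noncomputable def epsAvg (M : ∀ t, MDP (S t) (A t)) (ν : ∀ t, Measure (S t × A t))
    (Q : ∀ t, ℕ → S t × A t → ℝ) (k : ℕ) : ℝ≥0∞ :=
  (T : ℝ≥0∞)⁻¹ * ∑ t, eLpNorm (Q t (k + 1) - (M t).bellmanOpt (Q t k)) 2 (ν t) ^ 2

/-- `𝓔_avg(ε_0, …, ε_{K-1}; r) = ∑_{k<K} α_k^{2r} ε_k`, with `α_k` formed with `γ`. -/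
noncomputable def errAvg (γ : ℝ) (K : ℕ) (ε : ℕ → ℝ≥0∞) (r : ℝ) : ℝ≥0∞ :=
  ∑ k ∈ Finset.range K, ENNReal.ofReal (avgWeight γ K k ^ (2 * r)) * ε k

/-- `C_VI^{1/2}(K; r) = max_t C_{VI,ρ,ν}^{1/2}(K; t, r)`. -/
noncomputable def sqrtCVIMax (M : ∀ t, MDP (S t) (A t)) (ρ ν : ∀ t, Measure (S t × A t))
    (πstar : ∀ t, Policy (S t) (A t)) (K : ℕ) (r : ℝ) : ℝ≥0∞ :=
  ⨆ t, (M t).CVI (ρ t) (ν t) (πstar t) K r ^ (1 / 2 : ℝ)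

end MultiTask

/-! Fix a task with discount β, and let e_k = Q_{k+1} - T^*Q_k, u_k = (Q^* - Q_k)^+, v_k = (Q_k -
Q^*)^+. Comparing T^* with the operators of π^* and of the greedy policies π_k gives u_{k+1} ≤ |e_k|
+ β P^{π^*} u_k and v_{k+1} ≤ |e_k| + β P^{π_k} v_k, while the loss d = Q^* - Q^{π_K} ≥ 0 satisfies
d ≤ β P^{π^*} u_K + β P^{π_K} v_K + β P^{π_K} d. Unrolling all three against ρ leaves integrals of
|e_k| under laws ρ P⋯P; a change of measure to ν and Cauchy-Schwarz turn them into concentrability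
coefficients times ‖e_k‖_{2,ν} (`MDP.eLpNorm_optimal_sub_actionValue_le`). Positive parts keep
everything in [0,∞].

To average over tasks, the error weights must not depend on the task. The factor β^{K-k} is bounded
by a constant times α_k(β)^{1-r} α_k(γ)^r (`mul_pow_le_avgWeight_rpow_mul`); Cauchy-Schwarz over k
then separates C_VI from the errors (`MDP.sum_discountedCoeff_mul_le`), and concavity of the square
root averages the errors over t. -/

section MarkovChain

/-! ### Homogeneous Markov chains and iterates of their kernel. -/

variable {X : Type*} [MeasurableSpace X]

theorem MemB.integrable {f : X → ℝ} {L : ℝ} (hf : MemB f L) (μ : Measure X)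
    [IsFiniteMeasure μ] : Integrable f μ :=
  Integrable.of_bound hf.1.aestronglyMeasurable L (Filter.Eventually.of_forall hf.2)

theorem abs_integral_le_of_forall_abs_le {f : X → ℝ} {L : ℝ} (hf : ∀ x, |f x| ≤ L) (μ : Measure X)
    [IsProbabilityMeasure μ] : |∫ x, f x ∂μ| ≤ L := by
  simpa using norm_integral_le_of_norm_le_const (μ := μ) (f := f) (Filter.Eventually.of_forall hf)

/-- The action of a kernel on functions. -/
noncomputable def kernelOp (κ : Kernel X X) (f : X → ℝ) (x : X) : ℝ := ∫ y, f y ∂κ x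

variable (κ : Kernel X X) [IsMarkovKernel κ]

theorem memB_kernelOp {f : X → ℝ} {L : ℝ} (hf : MemB f L) : MemB (kernelOp κ f) L :=
  ⟨(hf.1.stronglyMeasurable.integral_kernel (κ := κ)).measurable,
    fun x => abs_integral_le_of_forall_abs_le hf.2 (κ x)⟩

theorem memB_kernelOp_iterate {f : X → ℝ} {L : ℝ} (hf : MemB f L) (n : ℕ) :
    MemB ((kernelOp κ)^[n] f) L := by
  induction n with
  | zero => exact hf
  | succ n ih => rw [Function.iterate_succ_apply']; exact memB_kernelOp κ ih

/-- The law of the homogeneous Markov chain with transition kernel `κ` started at `z`. -/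
noncomputable def chainLaw (z : X) : Measure (ℕ → X) :=
  Kernel.traj (X := fun _ => X)
    (fun n => κ.comap (fun h : (i : Finset.Iic n) → X => h ⟨n, Finset.mem_Iic.2 le_rfl⟩)
      (measurable_pi_apply _)) 0 (fun _ => z)

instance (z : X) : IsProbabilityMeasure (chainLaw κ z) := by
  unfold chainLaw; infer_instance

/-- Markov property: by the Ionescu-Tulcea construction, the past up to time n and the next state
have as joint law the law of the past composed with `κ`. -/
theorem integral_chainLaw_pair (z : X) (n : ℕ) {f : X × X → ℝ} {L : ℝ} (hf : MemB f L) :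
    ∫ ω, f (ω n, ω (n + 1)) ∂chainLaw κ z =
      ∫ ω, ∫ y, f (ω n, y) ∂κ (ω n) ∂chainLaw κ z := by
  set η : (n : ℕ) → Kernel ((i : Finset.Iic n) → X) X := fun n =>
    κ.comap (fun h : (i : Finset.Iic n) → X => h ⟨n, Finset.mem_Iic.2 le_rfl⟩)
      (measurable_pi_apply _) with hη
  have key := Kernel.partialTraj_compProd_eq_map_traj (X := fun _ => X) (κ := η)
    (Nat.zero_le n) (x₀ := fun _ => z)
  rw [← Kernel.traj_map_frestrictLe_apply (X := fun _ => X)] at key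
  set g : ((i : Finset.Iic n) → X) × X → ℝ := fun p => f (p.1 ⟨n, Finset.mem_Iic.2 le_rfl⟩, p.2)
  have hg : MemB g L := ⟨hf.1.comp (by fun_prop), fun p => hf.2 _⟩
  have h1 := congrArg (fun μ => ∫ p, g p ∂μ) key
  simp only at h1
  rw [integral_map (by fun_prop) hg.1.aestronglyMeasurable,
    Measure.integral_compProd (hg.integrable _),
    integral_map (by fun_prop)] at h1
  · exact h1.symm
  · exact (hg.1.stronglyMeasurable.integral_kernel_prod_right' (κ := η n)).aestronglyMeasurable

theorem integral_chainLaw_eval (z : X) (n : ℕ) {f : X → ℝ} {L : ℝ} (hf : MemB f L) :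
    ∫ ω, f (ω n) ∂chainLaw κ z = (kernelOp κ)^[n] f z := by
  induction n generalizing f with
  | zero =>
    have key := Kernel.traj_map_frestrictLe_apply (X := fun _ => X)
      (κ := fun n => κ.comap
        (fun h : (i : Finset.Iic n) → X => h ⟨n, Finset.mem_Iic.2 le_rfl⟩)
        (measurable_pi_apply _)) (a := 0) 0 (fun _ => z)
    rw [Kernel.partialTraj_self, Kernel.id_apply] at key
    have h1 := congrArg
      (fun μ => ∫ p : (i : Finset.Iic 0) → X, f (p ⟨0, Finset.mem_Iic.2 le_rfl⟩) ∂μ) key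
    have hm : Measurable fun p : (i : Finset.Iic 0) → X => f (p ⟨0, Finset.mem_Iic.2 le_rfl⟩) :=
      hf.1.comp (measurable_pi_apply _)
    rw [integral_map (by fun_prop) hm.aestronglyMeasurable,
      integral_dirac' _ _ hm.stronglyMeasurable] at h1
    exact h1
  | succ n ih =>
    rw [integral_chainLaw_pair κ z n (f := fun p => f p.2) (L := L)
      ⟨hf.1.comp measurable_snd, fun p => hf.2 _⟩]
    exact ih (memB_kernelOp κ hf)

end MarkovChain

/-! ### The action value as a discounted series, and its Bellman equation. -/

namespace MDP

variable {S A : Type*} [MeasurableSpace S] [MeasurableSpace A] (M : MDP S A)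

instance : IsMarkovKernel M.P := M.markov

theorem bound_nonneg {Rmax : ℝ} (hR : ∀ x, |M.R x| ≤ Rmax) (z : S × A) : 0 ≤ Rmax :=
  (abs_nonneg _).trans (hR (z.1, z.2, z.1))

theorem integral_policyKernel (π : Policy S A) (z : S × A) {f : S × A → ℝ} (hf : Measurable f) :
    ∫ y, f y ∂M.policyKernel π z = ∫ s', f (s', π.1 s') ∂M.P z := by
  have hm : Measurable fun s' => (s', π.1 s') := measurable_id.prodMk π.2
  rw [policyKernel, Kernel.map_apply _ hm, integral_map hm.aemeasurable hf.aestronglyMeasurable]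

/-- The expected immediate reward. -/
noncomputable def meanReward (z : S × A) : ℝ := ∫ s', M.R (z.1, z.2, s') ∂M.P z

theorem measurable_reward_section (z : S × A) : Measurable fun s' => M.R (z.1, z.2, s') :=
  M.measurable_R.comp (by fun_prop)

theorem memB_meanReward {Rmax : ℝ} (hR : ∀ x, |M.R x| ≤ Rmax) : MemB M.meanReward Rmax := by
  refine ⟨?_, fun z => abs_integral_le_of_forall_abs_le (fun s' => hR _) _⟩
  have h : Measurable fun p : (S × A) × S => M.R (p.1.1, p.1.2, p.2) :=
    M.measurable_R.comp (by fun_prop)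
  exact (h.stronglyMeasurable.integral_kernel_prod_right' (κ := M.P)).measurable

theorem integrable_reward {Rmax : ℝ} (hR : ∀ x, |M.R x| ≤ Rmax) (z : S × A) :
    Integrable (fun s' => M.R (z.1, z.2, s')) (M.P z) :=
  MemB.integrable ⟨M.measurable_reward_section z, fun _ => hR _⟩ _

/-- Geometric domination lets sum and expectation be exchanged; the Markov property then replaces
each reward by its conditional mean. -/
theorem actionValue_eq_tsum (hγ : M.γ < 1) {Rmax : ℝ} (hR : ∀ x, |M.R x| ≤ Rmax)
    (π : Policy S A) (z : S × A) :
    M.actionValue π z = ∑' k : ℕ, M.γ ^ k * (kernelOp (M.policyKernel π))^[k] M.meanReward z := by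
  have hterm : ∀ k, MemB (fun ω : ℕ → S × A =>
      M.γ ^ k * M.R ((ω k).1, (ω k).2, (ω (k + 1)).1)) (M.γ ^ k * Rmax) := fun k => by
    refine ⟨(M.measurable_R.comp (by fun_prop)).const_mul _, fun ω => ?_⟩
    rw [abs_mul, abs_of_nonneg (pow_nonneg M.γ_pos.le k)]
    exact mul_le_mul_of_nonneg_left (hR _) (pow_nonneg M.γ_pos.le k)
  change ∫ ω, ∑' k : ℕ, M.γ ^ k * M.R ((ω k).1, (ω k).2, (ω (k + 1)).1)
    ∂(chainLaw (M.policyKernel π) z) = _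
  rw [← integral_tsum_of_summable_integral_norm (fun k => (hterm k).integrable _)]
  · congr 1 with k
    rw [integral_const_mul, integral_chainLaw_pair (M.policyKernel π) z k
      (f := fun p => M.R (p.1.1, p.1.2, p.2.1)) (L := Rmax)
      ⟨M.measurable_R.comp (by fun_prop), fun _ => hR _⟩]
    rw [← integral_chainLaw_eval _ z k (M.memB_meanReward hR)]
    congr 2 with ω
    exact M.integral_policyKernel π (ω k) (f := fun y => M.R ((ω k).1, (ω k).2, y.1))
      (M.measurable_R.comp (by fun_prop))
  · refine Summable.of_nonneg_of_le (fun k => integral_nonneg fun _ => norm_nonneg _)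
      (fun k => ?_) ((summable_geometric_of_lt_one M.γ_pos.le hγ).mul_right Rmax)
    refine (le_abs_self _).trans (abs_integral_le_of_forall_abs_le (fun ω => ?_) _)
    rw [abs_norm]
    exact (hterm k).2 ω

theorem memB_discounted_iterate {Rmax : ℝ} (hR : ∀ x, |M.R x| ≤ Rmax) (π : Policy S A) (k : ℕ) :
    MemB (fun z => M.γ ^ k * (kernelOp (M.policyKernel π))^[k] M.meanReward z)
      (M.γ ^ k * Rmax) := by
  have h := memB_kernelOp_iterate (M.policyKernel π) (M.memB_meanReward hR) k
  refine ⟨h.1.const_mul _, fun z => ?_⟩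
  rw [abs_mul, abs_of_nonneg (pow_nonneg M.γ_pos.le k)]
  exact mul_le_mul_of_nonneg_left (h.2 z) (pow_nonneg M.γ_pos.le k)

theorem memB_actionValue (hγ : M.γ < 1) {Rmax : ℝ} (hR : ∀ x, |M.R x| ≤ Rmax)
    (π : Policy S A) : MemB (M.actionValue π) (Rmax / (1 - M.γ)) := by
  have hb := M.memB_discounted_iterate hR π
  have hs := (summable_geometric_of_lt_one M.γ_pos.le hγ).mul_right Rmax
  have hsum : ∀ z, Summable fun k : ℕ =>
      M.γ ^ k * (kernelOp (M.policyKernel π))^[k] M.meanReward z := fun z =>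
    Summable.of_norm_bounded hs fun k => (hb k).2 z
  rw [funext (M.actionValue_eq_tsum hγ hR π)]
  refine ⟨?_, fun z => ?_⟩
  · exact measurable_of_tendsto_metrizable
      (fun n => Finset.measurable_sum (Finset.range n) fun k _ => (hb k).1)
      (tendsto_pi_nhds.2 fun z => by
        simpa using (hsum z).hasSum.tendsto_sum_nat)
  · refine (tsum_of_norm_bounded (f := fun k : ℕ =>
      M.γ ^ k * (kernelOp (M.policyKernel π))^[k] M.meanReward z) hs.hasSum
      fun k => (hb k).2 z).trans_eq ?_
    rw [tsum_mul_right, tsum_geometric_of_lt_one M.γ_pos.le hγ, div_eq_inv_mul]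

/-- The Bellman equation for a policy. -/
theorem actionValue_eq (hγ : M.γ < 1) {Rmax : ℝ} (hR : ∀ x, |M.R x| ≤ Rmax)
    (π : Policy S A) (z : S × A) :
    M.actionValue π z =
      M.meanReward z + M.γ * ∫ s', M.actionValue π (s', π.1 s') ∂M.P z := by
  have hb := M.memB_discounted_iterate hR π
  have hs := (summable_geometric_of_lt_one M.γ_pos.le hγ).mul_right Rmax
  have hsum : ∀ z, Summable fun k : ℕ =>
      M.γ ^ k * (kernelOp (M.policyKernel π))^[k] M.meanReward z := fun z =>
    Summable.of_norm_bounded hs fun k => (hb k).2 z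
  rw [← M.integral_policyKernel π z (M.memB_actionValue hγ hR π).1,
    M.actionValue_eq_tsum hγ hR π z, (hsum z).tsum_eq_zero_add]
  congr 1
  · simp
  · simp_rw [M.actionValue_eq_tsum hγ hR π]
    rw [← integral_tsum_of_summable_integral_norm (fun k => (hb k).integrable _), ← tsum_mul_left]
    · congr 1 with k
      rw [integral_const_mul, Function.iterate_succ_apply', pow_succ', mul_assoc]
      rfl
    · refine Summable.of_nonneg_of_le (fun k => integral_nonneg fun _ => norm_nonneg _)
        (fun k => ?_) hs
      refine (le_abs_self _).trans (abs_integral_le_of_forall_abs_le (fun ω => ?_) _)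
      rw [abs_norm]
      exact (hb k).2 ω

end MDP

/-- The positive part of an integral is at most the integral of the positive part. This transfers
signed inequalities to [0,∞]. -/
theorem ofReal_integral_le_lintegral_ofReal {X : Type*} [MeasurableSpace X] {μ : Measure X}
    {f : X → ℝ} (hf : Integrable f μ) :
    ENNReal.ofReal (∫ x, f x ∂μ) ≤ ∫⁻ x, ENNReal.ofReal (f x) ∂μ := by
  have h : ∫ x, f x ∂μ ≤ ∫ x, max (f x) 0 ∂μ :=
    integral_mono hf hf.pos_part fun x => le_max_left _ _
  refine (ENNReal.ofReal_le_ofReal h).trans ?_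
  rw [ofReal_integral_eq_lintegral_ofReal hf.pos_part
    (Filter.Eventually.of_forall fun x => le_max_right _ _)]
  exact (lintegral_mono fun x => by simp)

/-! ### Bellman operators: comparison of policies, and differences as kernel integrals. -/

namespace MDP

variable {S A : Type*} [MeasurableSpace S] [MeasurableSpace A] (M : MDP S A)

/-- The Bellman operator of a policy. -/
noncomputable def bellmanPolicy (π : Policy S A) (Q : S × A → ℝ) (z : S × A) : ℝ :=
  M.meanReward z + M.γ * ∫ s', Q (s', π.1 s') ∂M.P z

theorem memB_comp_policy {Q : S × A → ℝ} {L : ℝ} (hQ : MemB Q L) (π : Policy S A) :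
    MemB (fun s => Q (s, π.1 s)) L :=
  ⟨hQ.1.comp (measurable_id.prodMk π.2), fun _ => hQ.2 _⟩

theorem iSup_eq_of_isGreedy {Q : S × A → ℝ} {π : Policy S A} (h : IsGreedy π Q) (s : S) :
    ⨆ a, Q (s, a) = Q (s, π.1 s) :=
  haveI : Nonempty A := ⟨π.1 s⟩
  le_antisymm (ciSup_le (h s)) (le_ciSup (f := fun a => Q (s, a)) ⟨_, by
    rintro _ ⟨a, rfl⟩; exact h s a⟩ (π.1 s))

theorem bellmanOpt_eq_bellmanPolicy {Rmax : ℝ} (hR : ∀ x, |M.R x| ≤ Rmax) {Q : S × A → ℝ} {L : ℝ}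
    (hQ : MemB Q L) {π : Policy S A} (h : IsGreedy π Q) :
    M.bellmanOpt Q = M.bellmanPolicy π Q := by
  ext z
  simp_rw [bellmanOpt, iSup_eq_of_isGreedy h]
  rw [integral_add (M.integrable_reward hR z)
    (((memB_comp_policy hQ π).integrable _).const_mul _), integral_const_mul]
  rfl

theorem bellmanPolicy_le_bellmanOpt {Rmax : ℝ} (hR : ∀ x, |M.R x| ≤ Rmax) {Q : S × A → ℝ} {L : ℝ}
    (hQ : MemB Q L) (hsup : Measurable fun s => ⨆ a, Q (s, a)) (π : Policy S A) (z : S × A) :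
    M.bellmanPolicy π Q z ≤ M.bellmanOpt Q z := by
  have : Nonempty A := ⟨z.2⟩
  -- Without an upper bound the real supremum would default to 0.
  have hbdd : ∀ s, BddAbove (Set.range fun a => Q (s, a)) := fun s =>
    ⟨L, by rintro _ ⟨a, rfl⟩; exact (abs_le.1 (hQ.2 (s, a))).2⟩
  have hsupB : MemB (fun s => ⨆ a, Q (s, a)) L := by
    refine ⟨hsup, fun s => abs_le.2 ⟨?_, ciSup_le fun a => (abs_le.1 (hQ.2 (s, a))).2⟩⟩
    exact (abs_le.1 (hQ.2 (s, z.2))).1.trans (le_ciSup (hbdd s) z.2)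
  have hint := hsupB.integrable (M.P z)
  rw [bellmanOpt, integral_add (M.integrable_reward hR z) (hint.const_mul _), integral_const_mul]
  refine add_le_add le_rfl (mul_le_mul_of_nonneg_left ?_ M.γ_pos.le)
  exact integral_mono ((memB_comp_policy hQ π).integrable _) hint
    fun s => le_ciSup (hbdd s) (π.1 s)

theorem memB_sub {X : Type*} [MeasurableSpace X] {f g : X → ℝ} {L L' : ℝ} (hf : MemB f L)
    (hg : MemB g L') : MemB (fun x => f x - g x) (L + L') :=
  ⟨hf.1.sub hg.1, fun x => (abs_sub _ _).trans (add_le_add (hf.2 x) (hg.2 x))⟩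

theorem bellmanPolicy_sub {Q Q' : S × A → ℝ} {L L' : ℝ} (hQ : MemB Q L) (hQ' : MemB Q' L')
    (π : Policy S A) (z : S × A) :
    M.bellmanPolicy π Q z - M.bellmanPolicy π Q' z =
      M.γ * ∫ y, (Q y - Q' y) ∂M.policyKernel π z := by
  rw [M.integral_policyKernel π z (memB_sub hQ hQ').1, integral_sub
    ((memB_comp_policy hQ π).integrable _) ((memB_comp_policy hQ' π).integrable _), bellmanPolicy,
    bellmanPolicy]
  ring

theorem ofReal_bellmanPolicy_sub_le {Q Q' : S × A → ℝ} {L L' : ℝ} (hQ : MemB Q L)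
    (hQ' : MemB Q' L') (π : Policy S A) (z : S × A) :
    ENNReal.ofReal (M.bellmanPolicy π Q z - M.bellmanPolicy π Q' z) ≤
      ENNReal.ofReal M.γ * ∫⁻ y, ENNReal.ofReal (Q y - Q' y) ∂M.policyKernel π z := by
  rw [M.bellmanPolicy_sub hQ hQ', ENNReal.ofReal_mul M.γ_pos.le]
  gcongr
  exact ofReal_integral_le_lintegral_ofReal ((memB_sub hQ hQ').integrable _)

theorem measurable_bellmanPolicy {Rmax : ℝ} (hR : ∀ x, |M.R x| ≤ Rmax) {Q : S × A → ℝ} {L : ℝ}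
    (hQ : MemB Q L) (π : Policy S A) : Measurable (M.bellmanPolicy π Q) := by
  have h := (memB_comp_policy hQ π).1.stronglyMeasurable
  exact (M.memB_meanReward hR).1.add ((h.integral_kernel (κ := M.P)).measurable.const_mul _)

/-! ### Laws of future state-action pairs and unrolling of recursions. -/

section FutureLaw

theorem futureLaw_append (μ : Measure (S × A)) (l l' : List (Policy S A)) :
    M.futureLaw μ (l ++ l') = M.futureLaw (M.futureLaw μ l) l' :=
  List.foldl_append

theorem futureLaw_cons (μ : Measure (S × A)) (π : Policy S A) (l : List (Policy S A)) :
    M.futureLaw μ (π :: l) = M.futureLaw (μ.bind (M.policyKernel π)) l := rfl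

theorem lintegral_futureLaw_append_singleton (μ : Measure (S × A)) (l : List (Policy S A))
    (π : Policy S A) {f : S × A → ℝ≥0∞} (hf : Measurable f) :
    ∫⁻ z, f z ∂M.futureLaw μ (l ++ [π]) =
      ∫⁻ z, ∫⁻ y, f y ∂M.policyKernel π z ∂M.futureLaw μ l := by
  rw [futureLaw_append]
  exact Measure.lintegral_bind (M.policyKernel π).aemeasurable hf.aemeasurable

instance isProbabilityMeasure_futureLaw (μ : Measure (S × A)) [IsProbabilityMeasure μ]
    (l : List (Policy S A)) : IsProbabilityMeasure (M.futureLaw μ l) := by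
  induction l generalizing μ with
  | nil => assumption
  | cons π l ih => rw [futureLaw_cons]; exact ih _

/-- A finite coefficient forces absolute continuity, so the integral is that of |f| times the
density under `ν`; Cauchy-Schwarz concludes. -/
theorem lintegral_enorm_le_concentrability_mul (ρ ν : Measure (S × A)) [IsProbabilityMeasure ρ]
    [IsProbabilityMeasure ν] (l : List (Policy S A)) (hc : M.concentrability ρ ν l ≠ ∞)
    {f : S × A → ℝ} (hf : Measurable f) :
    ∫⁻ z, ‖f z‖ₑ ∂M.futureLaw ρ l ≤ M.concentrability ρ ν l * eLpNorm f 2 ν := by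
  have hac : M.futureLaw ρ l ≪ ν := by
    by_contra h
    exact hc (if_neg h)
  rw [concentrability, if_pos hac, ← lintegral_rnDeriv_mul hac hf.enorm.aemeasurable,
    eLpNorm_eq_lintegral_rpow_enorm_toReal (by norm_num) (by norm_num)]
  refine (ENNReal.lintegral_mul_le_Lp_mul_Lq ν Real.HolderConjugate.two_two
    (Measure.measurable_rnDeriv _ ν).aemeasurable hf.enorm.aemeasurable).trans_eq ?_
  simp

/-- Unrolling an affine recursion along a sequence of policies. -/
theorem lintegral_le_sum_of_recursion (σ : ℕ → Policy S A) (w e : ℕ → S × A → ℝ≥0∞) (B : ℝ≥0∞)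
    (n : ℕ) (hw : ∀ k ≤ n, Measurable (w k)) (he : ∀ k < n, Measurable (e k))
    (h0 : ∀ z, w 0 z ≤ B)
    (hrec : ∀ k < n, ∀ z,
      w (k + 1) z ≤ e k z + ENNReal.ofReal M.γ * ∫⁻ y, w k y ∂M.policyKernel (σ k) z)
    (μ : Measure (S × A)) [IsProbabilityMeasure μ] :
    ∫⁻ z, w n z ∂μ ≤ ∑ k ∈ Finset.range n, ENNReal.ofReal M.γ ^ (n - 1 - k) *
        ∫⁻ z, e k z ∂M.futureLaw μ ((List.range (n - 1 - k)).map fun i => σ (n - 1 - i)) +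
      ENNReal.ofReal M.γ ^ n * B := by
  induction n generalizing μ with
  | zero =>
    simpa using (lintegral_mono h0).trans_eq (by simp : ∫⁻ _, B ∂μ = B)
  | succ n ih =>
    -- The last policy `σ n` acts first on the measure, so the induction hypothesis is used at the
    -- pushed-forward measure; hence the decreasing indices in the list.
    have ih' := ih (fun k hk => hw k (by omega)) (fun k hk => he k (by omega))
      (fun k hk => hrec k (by omega)) (μ.bind (M.policyKernel (σ n)))
    calc ∫⁻ z, w (n + 1) z ∂μ
        ≤ ∫⁻ z, (e n z + ENNReal.ofReal M.γ * ∫⁻ y, w n y ∂M.policyKernel (σ n) z) ∂μ :=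
          lintegral_mono (hrec n (by omega))
      _ = ∫⁻ z, e n z ∂μ +
            ENNReal.ofReal M.γ * ∫⁻ z, w n z ∂(μ.bind (M.policyKernel (σ n))) := by
          rw [lintegral_add_left (he n (by omega)), lintegral_const_mul' _ _ ENNReal.ofReal_ne_top,
            Measure.lintegral_bind (M.policyKernel (σ n)).aemeasurable
              (hw n (by omega)).aemeasurable]
      _ ≤ _ := by
          grw [ih']
          rw [Finset.sum_range_succ, mul_add, Finset.mul_sum, ← mul_assoc, ← pow_succ', ← add_assoc,
            add_comm (∫⁻ z, e n z ∂μ)]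
          refine add_le_add (add_le_add (le_of_eq ?_) ?_) le_rfl
          · refine Finset.sum_congr rfl fun k hk => ?_
            have hk' := Finset.mem_range.1 hk
            have h1 : n + 1 - 1 - k = (n - 1 - k) + 1 := by omega
            rw [h1, ← mul_assoc, ← pow_succ', List.range_succ_eq_map, List.map_cons, List.map_map,
              futureLaw_cons]
            congr 4
            funext i
            simp only [Function.comp]
            congr 1
            omega
          · simp [futureLaw]

/-- After n substitutions the remainder is at most γ^n `B`, which vanishes because `B` is finite. -/
theorem lintegral_le_tsum_of_recursion (hγ : M.γ < 1) (π : Policy S A) (d g : S × A → ℝ≥0∞)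
    (B : ℝ≥0∞) (hB : B ≠ ∞) (hd : Measurable d) (hg : Measurable g) (hdB : ∀ z, d z ≤ B)
    (hrec : ∀ z, d z ≤ g z + ENNReal.ofReal M.γ * ∫⁻ y, d y ∂M.policyKernel π z)
    (μ : Measure (S × A)) [IsProbabilityMeasure μ] :
    ∫⁻ z, d z ∂μ ≤
      ∑' m : ℕ, ENNReal.ofReal M.γ ^ m * ∫⁻ z, g z ∂M.futureLaw μ (List.replicate m π) := by
  have hn : ∀ n : ℕ, ∫⁻ z, d z ∂μ ≤ ∑ m ∈ Finset.range n, ENNReal.ofReal M.γ ^ m *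
      ∫⁻ z, g z ∂M.futureLaw μ (List.replicate m π) +
      ENNReal.ofReal M.γ ^ n * ∫⁻ z, d z ∂M.futureLaw μ (List.replicate n π) := by
    intro n
    induction n with
    | zero => simp [futureLaw]
    | succ n ih =>
      refine ih.trans ?_
      rw [Finset.sum_range_succ, add_assoc, List.replicate_succ',
        M.lintegral_futureLaw_append_singleton _ _ _ hd, pow_succ, mul_assoc, ← mul_add,
        ← lintegral_const_mul' _ _ ENNReal.ofReal_ne_top, ← lintegral_add_left hg]
      gcongr with z
      exact hrec z
  have hle : ∀ n : ℕ, ∫⁻ z, d z ∂μ ≤ ∑' m : ℕ, ENNReal.ofReal M.γ ^ m *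
      ∫⁻ z, g z ∂M.futureLaw μ (List.replicate m π) + ENNReal.ofReal M.γ ^ n * B := fun n => by
    refine (hn n).trans (add_le_add (ENNReal.sum_le_tsum _) ?_)
    gcongr
    exact (lintegral_mono hdB).trans_eq (by simp)
  have hlim : Filter.Tendsto (fun n : ℕ => ∑' m : ℕ, ENNReal.ofReal M.γ ^ m *
      ∫⁻ z, g z ∂M.futureLaw μ (List.replicate m π) + ENNReal.ofReal M.γ ^ n * B) Filter.atTop
      (nhds (∑' m : ℕ, ENNReal.ofReal M.γ ^ m *
        ∫⁻ z, g z ∂M.futureLaw μ (List.replicate m π) + 0 * B)) :=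
    tendsto_const_nhds.add (ENNReal.Tendsto.mul_const
      (ENNReal.tendsto_pow_atTop_nhds_zero_of_lt_one (by simpa using hγ)) (Or.inr hB))
  simpa using ge_of_tendsto' hlim hle

end FutureLaw

end MDP

/-! ### Propagation of the iteration errors for a single task. -/

namespace MDP

variable {S A : Type*} [MeasurableSpace S] [MeasurableSpace A] (M : MDP S A)

/-- The optimal action-value function dominates the value of every policy. -/
theorem actionValue_le_of_isOptimalActionValue (hγ : M.γ < 1) {Rmax : ℝ}
    (hR : ∀ x, |M.R x| ≤ Rmax) {Qstar : S × A → ℝ} (hQstar : M.IsOptimalActionValue Qstar)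
    (π : Policy S A) (z : S × A) : M.actionValue π z ≤ Qstar z := by
  obtain ⟨⟨L, hL⟩, hsup, hfix⟩ := hQstar
  have hV := M.memB_actionValue hγ hR π
  have hdiff := memB_sub hV hL
  -- Since T^π Q^* ≤ T^* Q^* = Q^*, the difference D = Q^π - Q^* satisfies D ≤ γ P^π D; iterating
  -- gains a factor γ each time.
  have hpow : ∀ n : ℕ, ∀ z, M.actionValue π z - Qstar z ≤ M.γ ^ n * (Rmax / (1 - M.γ) + L) := by
    intro n
    induction n with
    | zero => exact fun z => by simpa using (le_abs_self _).trans (hdiff.2 z)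
    | succ n ih =>
      intro z
      have h1 := M.bellmanPolicy_le_bellmanOpt hR hL hsup π z
      rw [hfix] at h1
      have h2 : M.actionValue π z = M.bellmanPolicy π (M.actionValue π) z :=
        M.actionValue_eq hγ hR π z
      have h3 := M.bellmanPolicy_sub hV hL π z
      have h4 : ∫ y, (M.actionValue π y - Qstar y) ∂M.policyKernel π z ≤
          M.γ ^ n * (Rmax / (1 - M.γ) + L) := by
        refine (integral_mono (hdiff.integrable _) (integrable_const _) ih).trans_eq (by simp)
      calc M.actionValue π z - Qstar z
          ≤ M.γ * ∫ y, (M.actionValue π y - Qstar y) ∂M.policyKernel π z := by linarith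
        _ ≤ M.γ * (M.γ ^ n * (Rmax / (1 - M.γ) + L)) :=
            mul_le_mul_of_nonneg_left h4 M.γ_pos.le
        _ = _ := by ring
  have hlim : Filter.Tendsto (fun n : ℕ => M.γ ^ n * (Rmax / (1 - M.γ) + L)) Filter.atTop
      (nhds (0 * (Rmax / (1 - M.γ) + L))) :=
    (tendsto_pow_atTop_nhds_zero_of_lt_one M.γ_pos.le hγ).mul_const _
  have := ge_of_tendsto' hlim fun n => hpow n z
  linarith

section ErrorPropagation

variable {M} {Rmax : ℝ} {Qstar Q Q' : S × A → ℝ} {πstar π : Policy S A} {L : ℝ}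

/-- Q^* = T^{π^*} Q^* and T^* Q ≥ T^{π^*} Q, so Q^* - Q' ≤ (T^* Q - Q') + γ P^{π^*}(Q^* - Q). -/
theorem ofReal_optimal_sub_le (hγ : M.γ < 1) (hR : ∀ x, |M.R x| ≤ Rmax)
    (hπstar : M.actionValue πstar = Qstar)
    (hQ : MemB Q L) (hπ : IsGreedy π Q) (z : S × A) :
    ENNReal.ofReal (Qstar z - Q' z) ≤ ‖(Q' - M.bellmanOpt Q) z‖ₑ +
      ENNReal.ofReal M.γ * ∫⁻ y, ENNReal.ofReal (Qstar y - Q y) ∂M.policyKernel πstar z := by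
  have hV : MemB Qstar _ := hπstar ▸ M.memB_actionValue hγ hR πstar
  have hsup : Measurable fun s => ⨆ a, Q (s, a) := by
    simp_rw [iSup_eq_of_isGreedy hπ]
    exact (memB_comp_policy hQ π).1
  have h1 := M.bellmanPolicy_le_bellmanOpt hR hQ hsup πstar z
  have h2 : Qstar z = M.bellmanPolicy πstar Qstar z := by
    subst hπstar; exact M.actionValue_eq hγ hR πstar z
  refine le_trans ?_ (add_le_add le_rfl (M.ofReal_bellmanPolicy_sub_le hV hQ πstar z))
  rw [← ofReal_norm]
  refine le_trans (ENNReal.ofReal_le_ofReal ?_) ENNReal.ofReal_add_le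
  have h3 := neg_abs_le (Q' z - M.bellmanOpt Q z)
  rw [Pi.sub_apply, Real.norm_eq_abs]
  linarith

/-- The roles are reversed: greediness gives T^* Q = T^π Q, while Q^* ≥ T^π Q^*, so the kernel is
now that of `π`. -/
theorem ofReal_sub_optimal_le (hR : ∀ x, |M.R x| ≤ Rmax)
    (hQstar : M.IsOptimalActionValue Qstar)
    (hQ : MemB Q L) (hπ : IsGreedy π Q) (z : S × A) :
    ENNReal.ofReal (Q' z - Qstar z) ≤ ‖(Q' - M.bellmanOpt Q) z‖ₑ +
      ENNReal.ofReal M.γ * ∫⁻ y, ENNReal.ofReal (Q y - Qstar y) ∂M.policyKernel π z := by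
  obtain ⟨⟨L', hL⟩, hsup, hfix⟩ := hQstar
  have h1 := M.bellmanPolicy_le_bellmanOpt hR hL hsup π z
  rw [hfix] at h1
  refine le_trans ?_ (add_le_add le_rfl (M.ofReal_bellmanPolicy_sub_le hQ hL π z))
  rw [← ofReal_norm]
  refine le_trans (ENNReal.ofReal_le_ofReal ?_) ENNReal.ofReal_add_le
  have h3 := le_abs_self (Q' z - M.bellmanOpt Q z)
  rw [Pi.sub_apply, Real.norm_eq_abs]
  rw [M.bellmanOpt_eq_bellmanPolicy hR hQ hπ] at h3 ⊢
  linarith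

/-- Insert T^{π^*} Q, T^π Q and T^π Q^* between Q^* and Q^π; greediness makes T^{π^*} Q - T^π Q ≤ 0,
and the other three differences are the three terms. -/
theorem enorm_optimal_sub_actionValue_le (hγ : M.γ < 1) (hR : ∀ x, |M.R x| ≤ Rmax)
    (hQstar : M.IsOptimalActionValue Qstar) (hπstar : M.actionValue πstar = Qstar)
    (hQ : MemB Q L) (hπ : IsGreedy π Q) (z : S × A) :
    ‖(Qstar - M.actionValue π) z‖ₑ ≤
      (ENNReal.ofReal M.γ * ∫⁻ y, ENNReal.ofReal (Qstar y - Q y) ∂M.policyKernel πstar z +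
        ENNReal.ofReal M.γ * ∫⁻ y, ENNReal.ofReal (Q y - Qstar y) ∂M.policyKernel π z) +
      ENNReal.ofReal M.γ * ∫⁻ y, ‖(Qstar - M.actionValue π) y‖ₑ ∂M.policyKernel π z := by
  have hV : MemB Qstar _ := hπstar ▸ M.memB_actionValue hγ hR πstar
  have hW := M.memB_actionValue hγ hR π
  have hnn : ∀ y, ‖(Qstar - M.actionValue π) y‖ₑ = ENNReal.ofReal (Qstar y - M.actionValue π y) :=
    fun y => by
      rw [Pi.sub_apply, Real.enorm_eq_ofReal
        (sub_nonneg.2 (M.actionValue_le_of_isOptimalActionValue hγ hR hQstar π y))]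
  simp_rw [hnn]
  have hsup : Measurable fun s => ⨆ a, Q (s, a) := by
    simp_rw [iSup_eq_of_isGreedy hπ]
    exact (memB_comp_policy hQ π).1
  have h1 := M.bellmanPolicy_le_bellmanOpt hR hQ hsup πstar z
  rw [M.bellmanOpt_eq_bellmanPolicy hR hQ hπ] at h1
  have h2 : Qstar z = M.bellmanPolicy πstar Qstar z := by
    subst hπstar; exact M.actionValue_eq hγ hR πstar z
  have h3 : M.actionValue π z = M.bellmanPolicy π (M.actionValue π) z :=
    M.actionValue_eq hγ hR π z
  refine le_trans ?_ (add_le_add (add_le_add (M.ofReal_bellmanPolicy_sub_le hV hQ πstar z)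
    (M.ofReal_bellmanPolicy_sub_le hQ hV π z)) (M.ofReal_bellmanPolicy_sub_le hV hW π z))
  refine le_trans (ENNReal.ofReal_le_ofReal ?_) (ENNReal.ofReal_add_le.trans
    (add_le_add ENNReal.ofReal_add_le le_rfl))
  linarith

end ErrorPropagation

/-- The discounted concentrability coefficient multiplying the error of iteration `k`. -/
noncomputable def discountedCoeff (ρ ν : Measure (S × A)) (πstar : Policy S A) (K : ℕ)
    (π : ℕ → Policy S A) (k : ℕ) : ℝ≥0∞ :=
  ∑' m : ℕ, ENNReal.ofReal (M.γ ^ m) *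
    (M.cVI1 ρ ν πstar m (K - k) (π K) + M.cVI2 ρ ν (m + 1) k K π)

-- Unrolling the loss gives m steps of π_K, followed by one step of π^* (towards u_K) or one more of
-- π_K (towards v_K), then the steps of the respective recursion. The last term collects the initial
-- errors u_0 and v_0, whence its factor 2, summed geometrically over m.
variable {M} in
theorem eLpNorm_optimal_sub_actionValue_le (hγ : M.γ < 1) (ρ ν : Measure (S × A))
    [IsProbabilityMeasure ρ] [IsProbabilityMeasure ν] {Rmax : ℝ} (hR : ∀ x, |M.R x| ≤ Rmax)
    (K : ℕ) {L : ℝ} {Q : ℕ → S × A → ℝ} (hQ : ∀ k ≤ K, MemB (Q k) L)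
    {π : ℕ → Policy S A} (hπ : ∀ k ≤ K, IsGreedy (π k) (Q k)) {Qstar : S × A → ℝ}
    (hQstar : M.IsOptimalActionValue Qstar) {πstar : Policy S A}
    (hπstar : M.actionValue πstar = Qstar)
    (hcoeff : ∀ k < K, M.discountedCoeff ρ ν πstar K π k ≠ ∞) :
    eLpNorm (Qstar - M.actionValue (π K)) 1 ρ ≤
      (∑ k ∈ Finset.range K, ENNReal.ofReal (M.γ * M.γ ^ (K - k - 1)) *
        M.discountedCoeff ρ ν πstar K π k * eLpNorm (Q (k + 1) - M.bellmanOpt (Q k)) 2 ν) +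
      ENNReal.ofReal (2 * M.γ * M.γ ^ K * (Rmax / (1 - M.γ) + L) / (1 - M.γ)) := by
  have hγ0 := M.γ_pos.le
  set g : ℝ≥0∞ := ENNReal.ofReal M.γ with hg
  have hV : MemB Qstar (Rmax / (1 - M.γ)) := hπstar ▸ M.memB_actionValue hγ hR πstar
  have hW := M.memB_actionValue hγ hR (π K)
  set B : ℝ≥0∞ := ENNReal.ofReal (Rmax / (1 - M.γ) + L) with hB
  set u : ℕ → S × A → ℝ≥0∞ := fun k z => ENNReal.ofReal (Qstar z - Q k z) with hu
  set v : ℕ → S × A → ℝ≥0∞ := fun k z => ENNReal.ofReal (Q k z - Qstar z) with hv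
  set e : ℕ → S × A → ℝ := fun k => Q (k + 1) - M.bellmanOpt (Q k) with he
  set N : ℕ → ℝ≥0∞ := fun k => eLpNorm (e k) 2 ν with hN
  have hum : ∀ k ≤ K, Measurable (u k) := fun k hk => (hV.1.sub (hQ k hk).1).ennreal_ofReal
  have hvm : ∀ k ≤ K, Measurable (v k) := fun k hk => ((hQ k hk).1.sub hV.1).ennreal_ofReal
  have hem : ∀ k < K, Measurable (e k) := fun k hk => by
    rw [he]
    simp only
    rw [M.bellmanOpt_eq_bellmanPolicy hR (hQ k hk.le) (hπ k hk.le)]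
    exact (hQ (k + 1) hk).1.sub (M.measurable_bellmanPolicy hR (hQ k hk.le) _)
  -- Every weight γ^m is positive, so a finite discounted sum makes each single coefficient finite.
  have hc : ∀ k < K, ∀ m : ℕ, M.cVI1 ρ ν πstar m (K - k) (π K) ≠ ∞ ∧
      M.cVI2 ρ ν (m + 1) k K π ≠ ∞ := fun k hk m => by
    have h1 := ENNReal.ne_top_of_tsum_ne_top (hcoeff k hk) m
    have h2 : ENNReal.ofReal (M.γ ^ m) ≠ 0 := by
      simpa using pow_pos M.γ_pos m
    have h3 : M.cVI1 ρ ν πstar m (K - k) (π K) + M.cVI2 ρ ν (m + 1) k K π ≠ ∞ := fun h =>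
      h1 (by rw [h, ENNReal.mul_top h2])
    exact ENNReal.add_ne_top.1 h3
  have huK : ∀ m : ℕ, ∫⁻ z, u K z ∂M.futureLaw ρ (List.replicate m (π K) ++ [πstar]) ≤
      ∑ k ∈ Finset.range K, g ^ (K - 1 - k) * (M.cVI1 ρ ν πstar m (K - k) (π K) * N k) +
        g ^ K * B := fun m => by
    refine (M.lintegral_le_sum_of_recursion (fun _ => πstar) u (fun k z => ‖e k z‖ₑ) B K hum
      (fun k hk => (hem k hk).enorm) (fun z => ?_) (fun k hk z => ?_) _).trans
      (add_le_add (Finset.sum_le_sum fun k hk => ?_) le_rfl)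
    · exact ENNReal.ofReal_le_ofReal
        ((le_abs_self _).trans ((memB_sub hV (hQ 0 K.zero_le)).2 z))
    · exact ofReal_optimal_sub_le hγ hR hπstar (hQ k hk.le) (hπ k hk.le) z
    · have hk' := Finset.mem_range.1 hk
      have hl : (List.replicate m (π K) ++ [πstar]) ++
          (List.range (K - 1 - k)).map (fun _ => πstar) =
          List.replicate m (π K) ++ List.replicate (K - k) πstar := by
        rw [List.map_const', List.length_range, List.append_assoc, List.singleton_append,
          ← List.replicate_succ]
        congr 2
        omega
      gcongr
      rw [← futureLaw_append, hl]
      exact M.lintegral_enorm_le_concentrability_mul ρ ν _ (hc k hk' m).1 (hem k hk')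
  have hvK : ∀ m : ℕ, ∫⁻ z, v K z ∂M.futureLaw ρ (List.replicate m (π K) ++ [π K]) ≤
      ∑ k ∈ Finset.range K, g ^ (K - 1 - k) * (M.cVI2 ρ ν (m + 1) k K π * N k) +
        g ^ K * B := fun m => by
    refine (M.lintegral_le_sum_of_recursion π v (fun k z => ‖e k z‖ₑ) B K hvm
      (fun k hk => (hem k hk).enorm) (fun z => ?_) (fun k hk z => ?_) _).trans
      (add_le_add (Finset.sum_le_sum fun k hk => ?_) le_rfl)
    · refine ENNReal.ofReal_le_ofReal ((neg_sub (Qstar z) (Q 0 z) ▸ neg_le_abs _).trans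
        ((memB_sub hV (hQ 0 K.zero_le)).2 z))
    · exact ofReal_sub_optimal_le hR hQstar (hQ k hk.le) (hπ k hk.le) z
    · have hk' := Finset.mem_range.1 hk
      gcongr
      rw [← futureLaw_append, ← List.replicate_succ']
      exact M.lintegral_enorm_le_concentrability_mul ρ ν _ (hc k hk' m).2 (hem k hk')
  have hPu : Measurable fun z => ∫⁻ y, u K y ∂M.policyKernel πstar z :=
    (hum K le_rfl).lintegral_kernel
  have hPv : Measurable fun z => ∫⁻ y, v K y ∂M.policyKernel (π K) z :=
    (hvm K le_rfl).lintegral_kernel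
  rw [eLpNorm_one_eq_lintegral_enorm]
  have hmain := M.lintegral_le_tsum_of_recursion hγ (π K)
    (fun z => ‖(Qstar - M.actionValue (π K)) z‖ₑ)
    (fun z => g * ∫⁻ y, u K y ∂M.policyKernel πstar z +
      g * ∫⁻ y, v K y ∂M.policyKernel (π K) z)
    (ENNReal.ofReal (Rmax / (1 - M.γ) + Rmax / (1 - M.γ))) ENNReal.ofReal_ne_top
    (hV.1.sub hW.1).enorm ((hPu.const_mul _).add (hPv.const_mul _))
    (fun z => by
      rw [← ofReal_norm]
      exact ENNReal.ofReal_le_ofReal ((memB_sub hV hW).2 z))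
    (fun z => enorm_optimal_sub_actionValue_le hγ hR hQstar hπstar (hQ K le_rfl) (hπ K le_rfl) z)
    ρ
  refine hmain.trans ?_
  have hterm : ∀ m : ℕ, g ^ m * ∫⁻ z, (g * ∫⁻ y, u K y ∂M.policyKernel πstar z +
      g * ∫⁻ y, v K y ∂M.policyKernel (π K) z) ∂M.futureLaw ρ (List.replicate m (π K)) ≤
      ∑ k ∈ Finset.range K, g * g ^ (K - 1 - k) * N k * (ENNReal.ofReal (M.γ ^ m) *
        (M.cVI1 ρ ν πstar m (K - k) (π K) + M.cVI2 ρ ν (m + 1) k K π)) +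
      g ^ m * (2 * g * g ^ K * B) := fun m => by
    rw [lintegral_add_left (hPu.const_mul _), lintegral_const_mul _ hPu, lintegral_const_mul _ hPv,
      ← M.lintegral_futureLaw_append_singleton _ _ _ (hum K le_rfl),
      ← M.lintegral_futureLaw_append_singleton _ _ _ (hvm K le_rfl)]
    grw [huK m, hvK m]
    rw [ENNReal.ofReal_pow hγ0, ← hg]
    apply le_of_eq
    simp only [mul_add, Finset.mul_sum, Finset.sum_add_distrib]
    have h1 : ∀ c : ℕ → ℝ≥0∞, ∑ k ∈ Finset.range K, g ^ m * (g * (g ^ (K - 1 - k) * (c k * N k))) =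
        ∑ k ∈ Finset.range K, g * g ^ (K - 1 - k) * N k * (g ^ m * c k) := fun c =>
      Finset.sum_congr rfl fun k _ => by ring
    rw [h1, h1]
    ring
  refine (ENNReal.tsum_le_tsum hterm).trans ?_
  rw [ENNReal.tsum_add, Summable.tsum_finsetSum fun _ _ => ENNReal.summable, ENNReal.tsum_mul_right,
    ENNReal.tsum_geometric]
  refine add_le_add (Finset.sum_le_sum fun k _ => ?_) ?_
  · rw [ENNReal.tsum_mul_left, ENNReal.ofReal_mul hγ0, ENNReal.ofReal_pow hγ0,
      Nat.sub_right_comm K k 1, ← hg, mul_right_comm]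
    rfl
  · apply le_of_eq
    have h1 : (1 - g)⁻¹ = ENNReal.ofReal (1 - M.γ)⁻¹ := by
      rw [ENNReal.ofReal_inv_of_pos (sub_pos.2 hγ), ENNReal.ofReal_sub _ hγ0, ENNReal.ofReal_one]
    rw [h1, div_eq_inv_mul, ENNReal.ofReal_mul (inv_nonneg.2 (sub_pos.2 hγ).le),
      ENNReal.ofReal_mul (by positivity), ENNReal.ofReal_mul (by positivity),
      ENNReal.ofReal_mul (by positivity), ENNReal.ofReal_pow hγ0]
    simp [hg, hB]

end MDP

/-! ### Weights, Cauchy-Schwarz and concavity inequalities. -/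

theorem avgWeight_ge {γ : ℝ} (h0 : 0 < γ) (h1 : γ < 1) {K k : ℕ} (hk : k < K) :
    (1 - γ) * γ ^ (K - k - 1) ≤ avgWeight γ K k := by
  have h2 : γ ^ (K + 1) < 1 := pow_lt_one₀ h0.le h1 (by omega)
  have h3 : 0 < γ ^ (K + 1) := pow_pos h0 _
  rw [avgWeight, if_pos hk, le_div_iff₀ (by linarith)]
  exact mul_le_of_le_one_right (mul_nonneg (by linarith) (by positivity)) (by linarith)

theorem avgWeight_pos {γ : ℝ} (h0 : 0 < γ) (h1 : γ < 1) {K k : ℕ} (hk : k < K) :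
    0 < avgWeight γ K k :=
  (mul_pos (sub_pos.2 h1) (pow_pos h0 _)).trans_le (avgWeight_ge h0 h1 hk)

/-- Comparison of the weights formed with a discount factor `β` and with a larger one `γ`. -/
theorem mul_pow_le_avgWeight_rpow_mul {β γ : ℝ} (h0 : 0 < β) (hβγ : β ≤ γ) (h1 : γ < 1) {K k : ℕ}
    (hk : k < K) {r : ℝ} (hr : r ∈ Set.Icc (0 : ℝ) 1) :
    β * β ^ (K - k - 1) ≤ 2 * γ / (1 - γ) ^ 2 *
      ((1 - β) / 2 * (avgWeight β K k ^ (1 - r) * avgWeight γ K k ^ r)) := by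
  -- `x` mixes the two discounts so as to lie below both weights, hence below their weighted
  -- geometric mean for every r.
  set x := (1 - γ) * β ^ (K - k - 1) with hx
  have hx0 : 0 < x := mul_pos (sub_pos.2 h1) (pow_pos h0 _)
  have hβ : x ≤ avgWeight β K k :=
    le_trans (by rw [hx]; gcongr) (avgWeight_ge h0 (hβγ.trans_lt h1) hk)
  have hγ : x ≤ avgWeight γ K k :=
    le_trans (by rw [hx]; gcongr) (avgWeight_ge (h0.trans_le hβγ) h1 hk)
  have hprod : x ≤ avgWeight β K k ^ (1 - r) * avgWeight γ K k ^ r := by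
    calc x = x ^ (1 - r) * x ^ r := by
          rw [← Real.rpow_add hx0, sub_add_cancel, Real.rpow_one]
      _ ≤ _ := mul_le_mul (Real.rpow_le_rpow hx0.le hβ (sub_nonneg.2 hr.2))
          (Real.rpow_le_rpow hx0.le hγ hr.1) (by positivity)
          (Real.rpow_nonneg (hx0.le.trans hβ) _)
  have hg : 0 < 1 - γ := sub_pos.2 h1
  calc β * β ^ (K - k - 1) ≤ γ * β ^ (K - k - 1) := by gcongr
    -- One factor 1 - γ comes from `x`, the other from weakening the (1 - β)/2 in C_VI.
    _ = 2 * γ / (1 - γ) ^ 2 * ((1 - γ) / 2 * x) := by rw [hx]; field_simp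
    _ ≤ _ := by
      have h2 : 0 < γ := h0.trans_le hβγ
      have h3 : 0 < 1 - β := by linarith
      gcongr

theorem ofReal_rpow_two_mul {x : ℝ} (hx : 0 < x) (s : ℝ) :
    ENNReal.ofReal (x ^ (2 * s)) = ENNReal.ofReal (x ^ s) ^ 2 := by
  rw [← ENNReal.ofReal_pow (by positivity), mul_comm, Real.rpow_mul hx.le]
  norm_num

/-- Cauchy-Schwarz for finite sums of extended nonnegative reals. -/
theorem sum_mul_le_sqrt_mul_sqrt {ι : Type*} (s : Finset ι) (f g : ι → ℝ≥0∞) :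
    ∑ i ∈ s, f i * g i ≤ (∑ i ∈ s, f i ^ 2) ^ (1 / 2 : ℝ) * (∑ i ∈ s, g i ^ 2) ^ (1 / 2 : ℝ) := by
  simpa using ENNReal.inner_le_Lp_mul_Lq s f g Real.HolderConjugate.two_two

/-- Concavity of the square root for uniform averages. -/
theorem average_sqrt_le_sqrt_average {T : ℕ} [NeZero T] (f : Fin T → ℝ≥0∞) :
    (T : ℝ≥0∞)⁻¹ * ∑ t, f t ^ (1 / 2 : ℝ) ≤ ((T : ℝ≥0∞)⁻¹ * ∑ t, f t) ^ (1 / 2 : ℝ) := by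
  have h := ENNReal.rpow_arith_mean_le_arith_mean_rpow Finset.univ
    (fun _ : Fin T => (T : ℝ≥0∞)⁻¹) (fun t => f t ^ (1 / 2 : ℝ))
    (by simp [ENNReal.mul_inv_cancel (NeZero.ne (T : ℝ≥0∞)) (ENNReal.natCast_ne_top T)])
    one_le_two
  simp_rw [← ENNReal.rpow_mul, ← Finset.mul_sum] at h
  norm_num at h
  rw [one_div, ENNReal.le_rpow_inv_iff two_pos]
  simpa using h

/-! ### From discounted coefficients to C_VI. -/

namespace MDP

variable {S A : Type*} [MeasurableSpace S] [MeasurableSpace A] (M : MDP S A)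

theorem discountedCoeff_sum_le_CVI (ρ ν : Measure (S × A)) (πstar : Policy S A) (K : ℕ) (r : ℝ)
    (π : ℕ → Policy S A) :
    ENNReal.ofReal (((1 - M.γ) / 2) ^ 2) * ∑ k ∈ Finset.range K,
      ENNReal.ofReal (avgWeight M.γ K k ^ (2 * (1 - r))) *
        M.discountedCoeff ρ ν πstar K π k ^ 2 ≤ M.CVI ρ ν πstar K r := by
  unfold CVI discountedCoeff
  gcongr
  exact le_iSup (fun π' : ℕ → Policy S A => ∑ k ∈ Finset.range K,
      ENNReal.ofReal (avgWeight M.γ K k ^ (2 * (1 - r))) *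
        (∑' m : ℕ, ENNReal.ofReal (M.γ ^ m) *
          (M.cVI1 ρ ν πstar m (K - k) (π' K) + M.cVI2 ρ ν (m + 1) k K π')) ^ 2) π

theorem discountedCoeff_ne_top (hγ : M.γ < 1) {ρ ν : Measure (S × A)} {πstar : Policy S A} {K : ℕ}
    {r : ℝ} (hC : M.CVI ρ ν πstar K r ≠ ∞) (π : ℕ → Policy S A) {k : ℕ} (hk : k < K) :
    M.discountedCoeff ρ ν πstar K π k ≠ ∞ := by
  intro h
  refine hC (top_le_iff.1 (le_trans (top_le_iff.2 ?_)
    (M.discountedCoeff_sum_le_CVI ρ ν πstar K r π)))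
  have h1 : ENNReal.ofReal (((1 - M.γ) / 2) ^ 2) ≠ 0 := by
    have : 0 < 1 - M.γ := sub_pos.2 hγ
    exact (ENNReal.ofReal_pos.2 (by positivity)).ne'
  have h2 : ENNReal.ofReal (avgWeight M.γ K k ^ (2 * (1 - r))) ≠ 0 := by
    simpa using Real.rpow_pos_of_pos (avgWeight_pos M.γ_pos hγ hk) _
  rw [ENNReal.sum_eq_top.2 ⟨k, Finset.mem_range.2 hk, by simp [h, ENNReal.mul_top h2]⟩,
    ENNReal.mul_top h1]

/-- The weighted error sum is controlled by the concentrability coefficient. -/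
theorem sum_discountedCoeff_mul_le {γ : ℝ} (hMγ : M.γ ≤ γ) (hγ : γ < 1) (ρ ν : Measure (S × A))
    (πstar : Policy S A) (K : ℕ) {r : ℝ} (hr : r ∈ Set.Icc (0 : ℝ) 1) (π : ℕ → Policy S A)
    (N : ℕ → ℝ≥0∞) :
    ∑ k ∈ Finset.range K, ENNReal.ofReal (M.γ * M.γ ^ (K - k - 1)) *
        M.discountedCoeff ρ ν πstar K π k * N k ≤
      ENNReal.ofReal (2 * γ / (1 - γ) ^ 2) * (M.CVI ρ ν πstar K r ^ (1 / 2 : ℝ) *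
        (∑ k ∈ Finset.range K, ENNReal.ofReal (avgWeight γ K k ^ (2 * r)) * N k ^ 2)
          ^ (1 / 2 : ℝ)) := by
  have hM1 : M.γ < 1 := hMγ.trans_lt hγ
  have hγ0 : 0 < γ := M.γ_pos.trans_le hMγ
  have hb : 0 ≤ (1 - M.γ) / 2 := by linarith
  set D := M.discountedCoeff ρ ν πstar K π
  set b := ENNReal.ofReal ((1 - M.γ) / 2)
  -- Split for Cauchy-Schwarz: the squares of `F` sum to at most C_VI, those of `G` to the weighted
  -- error.
  set F : ℕ → ℝ≥0∞ := fun k => b * (ENNReal.ofReal (avgWeight M.γ K k ^ (1 - r)) * D k)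
  set G : ℕ → ℝ≥0∞ := fun k => ENNReal.ofReal (avgWeight γ K k ^ r) * N k
  have hF : ∑ k ∈ Finset.range K, F k ^ 2 ≤ M.CVI ρ ν πstar K r := by
    refine le_trans (le_of_eq ?_) (M.discountedCoeff_sum_le_CVI ρ ν πstar K r π)
    rw [Finset.mul_sum, ENNReal.ofReal_pow hb]
    refine Finset.sum_congr rfl fun k hk => ?_
    rw [ofReal_rpow_two_mul (avgWeight_pos M.γ_pos hM1 (Finset.mem_range.1 hk)), mul_pow, mul_pow]
  have hG : ∑ k ∈ Finset.range K, G k ^ 2 =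
      ∑ k ∈ Finset.range K, ENNReal.ofReal (avgWeight γ K k ^ (2 * r)) * N k ^ 2 :=
    Finset.sum_congr rfl fun k hk => by
      rw [ofReal_rpow_two_mul (avgWeight_pos hγ0 hγ (Finset.mem_range.1 hk)), mul_pow]
  calc _ ≤ ∑ k ∈ Finset.range K, ENNReal.ofReal (2 * γ / (1 - γ) ^ 2) * (F k * G k) := by
        refine Finset.sum_le_sum fun k hk => ?_
        have hk' := Finset.mem_range.1 hk
        have h1 := (avgWeight_pos M.γ_pos hM1 hk').le
        have h2 := (avgWeight_pos hγ0 hγ hk').le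
        have hle := ENNReal.ofReal_le_ofReal
          (mul_pow_le_avgWeight_rpow_mul M.γ_pos hMγ hγ hk' hr)
        grw [hle]
        rw [ENNReal.ofReal_mul (by positivity), ENNReal.ofReal_mul hb,
          ENNReal.ofReal_mul (by positivity)]
        apply le_of_eq
        simp only [F, G, b]
        ring
    _ = ENNReal.ofReal (2 * γ / (1 - γ) ^ 2) * ∑ k ∈ Finset.range K, F k * G k :=
        (Finset.mul_sum _ _ _).symm
    _ ≤ _ := by
        grw [sum_mul_le_sqrt_mul_sqrt, hF, hG]

end MDP

/-! ### Averaging over the tasks. -/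

/-- The sums over tasks and iterations commute because the weights use the common discount `γ`. -/
theorem errAvg_epsAvg {T : ℕ} {S A : Fin T → Type*} [∀ t, MeasurableSpace (S t)]
    [∀ t, MeasurableSpace (A t)] (M : ∀ t, MDP (S t) (A t)) (ν : ∀ t, Measure (S t × A t))
    (Q : ∀ t, ℕ → S t × A t → ℝ) (γ : ℝ) (K : ℕ) (r : ℝ) :
    errAvg γ K (epsAvg M ν Q) r = (T : ℝ≥0∞)⁻¹ * ∑ t, ∑ k ∈ Finset.range K,
      ENNReal.ofReal (avgWeight γ K k ^ (2 * r)) *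
        eLpNorm (Q t (k + 1) - (M t).bellmanOpt (Q t k)) 2 (ν t) ^ 2 := by
  unfold errAvg epsAvg
  rw [Finset.sum_comm, Finset.mul_sum]
  refine Finset.sum_congr rfl fun k _ => ?_
  rw [← Finset.mul_sum, mul_left_comm]

theorem theorem2 {T : ℕ} [NeZero T] {S A : Fin T → Type*}
    [∀ t, MeasurableSpace (S t)] [∀ t, MeasurableSpace (A t)]
    (M : ∀ t, MDP (S t) (A t)) (hγ : ∀ t, (M t).γ < 1)
    (ρ ν : ∀ t, Measure (S t × A t))
    [∀ t, IsProbabilityMeasure (ρ t)] [∀ t, IsProbabilityMeasure (ν t)]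
    (Rmax : Fin T → ℝ) (hR : ∀ t x, |(M t).R x| ≤ Rmax t)
    (K : ℕ) (hK : 0 < K)
    (Qmax : Fin T → ℝ) (hQmax : ∀ t, Qmax t ≤ Rmax t / (1 - maxDiscount M))
    (Q : ∀ t, ℕ → S t × A t → ℝ) (hQ : ∀ t, ∀ k ≤ K, MemB (Q t k) (Qmax t))
    (π : ∀ t, ℕ → Policy (S t) (A t)) (hπ : ∀ t, ∀ k ≤ K, IsGreedy (π t k) (Q t k))
    (Qstar : ∀ t, S t × A t → ℝ) (hQstar : ∀ t, (M t).IsOptimalActionValue (Qstar t))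
    (πstar : ∀ t, Policy (S t) (A t)) (hπstar : ∀ t, (M t).actionValue (πstar t) = Qstar t) :
    (T : ℝ≥0∞)⁻¹ * ∑ t, eLpNorm (Qstar t - (M t).actionValue (π t K)) 1 (ρ t) ≤
      ENNReal.ofReal (2 * maxDiscount M / (1 - maxDiscount M) ^ 2) *
        ((⨅ r ∈ Set.Icc (0 : ℝ) 1,
            coeffMul (sqrtCVIMax M ρ ν πstar K r)
              (errAvg (maxDiscount M) K (epsAvg M ν Q) r ^ (1 / 2 : ℝ))) +
          ENNReal.ofReal
            (2 * maxDiscount M ^ K * ((T : ℝ)⁻¹ * ∑ t, Rmax t) / (1 - maxDiscount M))) := by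
  set γ := maxDiscount M with hγdef
  have hle : ∀ t, (M t).γ ≤ γ := fun t =>
    le_ciSup (f := fun t => (M t).γ) (Set.finite_range _).bddAbove t
  have hγ1 : γ < 1 := by
    obtain ⟨t, ht⟩ := exists_eq_ciSup_of_finite (f := fun t => (M t).γ)
    rw [hγdef, maxDiscount, ← ht]
    exact hγ t
  have hγ0 : 0 < γ := (M 0).γ_pos.trans_le (hle 0)
  have hRnn : ∀ t, 0 ≤ Rmax t := fun t =>
    (nonempty_of_isProbabilityMeasure (ρ t)).elim fun z => (M t).bound_nonneg (hR t) z
  have h1γ : 0 < 1 - γ := sub_pos.2 hγ1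
  set c := 2 * γ / (1 - γ) ^ 2 with hc
  have hc0 : 0 < c := by positivity
  rw [mul_add, ENNReal.mul_iInf_of_ne (by simpa using hc0) ENNReal.ofReal_ne_top]
  simp_rw [ENNReal.mul_iInf_of_ne (a := ENNReal.ofReal c) (by simpa using hc0)
    ENNReal.ofReal_ne_top, ENNReal.iInf_add]
  refine le_iInf₂ fun r hr => ?_
  -- By the convention in `coeffMul` the bound is void here; otherwise every task has a finite C_VI.
  by_cases htop : sqrtCVIMax M ρ ν πstar K r = ∞
  · simp [coeffMul, htop, ENNReal.mul_top, hc0]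
  rw [coeffMul, if_neg htop]
  have hCt : ∀ t, (M t).CVI (ρ t) (ν t) (πstar t) K r ^ (1 / 2 : ℝ) ≤
      sqrtCVIMax M ρ ν πstar K r := fun t =>
    le_iSup (fun t => (M t).CVI (ρ t) (ν t) (πstar t) K r ^ (1 / 2 : ℝ)) t
  have hCfin : ∀ t, (M t).CVI (ρ t) (ν t) (πstar t) K r ≠ ∞ := fun t h => by
    have := hCt t
    rw [h, ENNReal.top_rpow_of_pos (by norm_num), top_le_iff] at this
    exact htop this
  set E : Fin T → ℝ≥0∞ := fun t => ∑ k ∈ Finset.range K,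
    ENNReal.ofReal (avgWeight γ K k ^ (2 * r)) *
      eLpNorm (Q t (k + 1) - (M t).bellmanOpt (Q t k)) 2 (ν t) ^ 2 with hE
  have htask : ∀ t, eLpNorm (Qstar t - (M t).actionValue (π t K)) 1 (ρ t) ≤
      ENNReal.ofReal c * (sqrtCVIMax M ρ ν πstar K r * E t ^ (1 / 2 : ℝ)) +
        ENNReal.ofReal (c * (2 * γ ^ K * Rmax t / (1 - γ))) := fun t => by
    refine (MDP.eLpNorm_optimal_sub_actionValue_le (hγ t) (ρ t) (ν t) (hR t) K (hQ t) (hπ t)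
      (hQstar t) (hπstar t)
      (fun k hk => (M t).discountedCoeff_ne_top (hγ t) (hCfin t) (π t) hk)).trans ?_
    refine add_le_add (((M t).sum_discountedCoeff_mul_le (hle t) hγ1 (ρ t) (ν t) (πstar t) K hr
      (π t) _).trans ?_) (ENNReal.ofReal_le_ofReal ?_)
    · grw [hCt t]
    · have hβ0 := (M t).γ_pos
      have hβ := hle t
      have hRt := hRnn t
      have h1β : 1 - γ ≤ 1 - (M t).γ := by linarith
      have hsum : Rmax t / (1 - (M t).γ) + Qmax t ≤ 2 * (Rmax t / (1 - γ)) := by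
        have h2 : Rmax t / (1 - (M t).γ) ≤ Rmax t / (1 - γ) := by gcongr
        linarith [hQmax t]
      have hQnn : 0 ≤ Qmax t := (nonempty_of_isProbabilityMeasure (ρ t)).elim fun z =>
        (abs_nonneg _).trans ((hQ t 0 hK.le).2 z)
      have hsum0 : 0 ≤ Rmax t / (1 - (M t).γ) + Qmax t :=
        add_nonneg (div_nonneg hRt (h1γ.le.trans h1β)) hQnn
      calc 2 * (M t).γ * (M t).γ ^ K * (Rmax t / (1 - (M t).γ) + Qmax t) / (1 - (M t).γ)
          ≤ 2 * γ * γ ^ K * (2 * (Rmax t / (1 - γ))) / (1 - γ) := by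
            gcongr
        -- A factor 1 - γ is given away so that the remainder also carries the prefactor `c`.
        _ ≤ 2 * γ * γ ^ K * (2 * (Rmax t / (1 - γ))) / (1 - γ) ^ 2 := by
            gcongr
            nlinarith
        _ = _ := by rw [hc]; ring
  calc (T : ℝ≥0∞)⁻¹ * ∑ t, eLpNorm (Qstar t - (M t).actionValue (π t K)) 1 (ρ t)
      ≤ (T : ℝ≥0∞)⁻¹ * ∑ t, (ENNReal.ofReal c *
          (sqrtCVIMax M ρ ν πstar K r * E t ^ (1 / 2 : ℝ)) +
          ENNReal.ofReal (c * (2 * γ ^ K * Rmax t / (1 - γ)))) := by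
        gcongr with t
        exact htask t
    _ = ENNReal.ofReal c * (sqrtCVIMax M ρ ν πstar K r *
          ((T : ℝ≥0∞)⁻¹ * ∑ t, E t ^ (1 / 2 : ℝ))) +
          ENNReal.ofReal c * ENNReal.ofReal
            (2 * γ ^ K * ((T : ℝ)⁻¹ * ∑ t, Rmax t) / (1 - γ)) := by
        rw [Finset.sum_add_distrib, ← Finset.mul_sum, ← Finset.mul_sum, mul_add]
        congr 1
        · ring
        · have hT : (T : ℝ≥0∞)⁻¹ = ENNReal.ofReal (T : ℝ)⁻¹ := by
            rw [ENNReal.ofReal_inv_of_pos (by exact_mod_cast NeZero.pos T),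
              ENNReal.ofReal_natCast]
          rw [← ENNReal.ofReal_sum_of_nonneg fun t _ => by have := hRnn t; positivity, hT,
            ← ENNReal.ofReal_mul (by positivity), ← ENNReal.ofReal_mul hc0.le]
          congr 1
          rw [← Finset.mul_sum, ← Finset.sum_div, ← Finset.mul_sum]
          ring
    _ ≤ _ := by
        rw [errAvg_epsAvg]
        grw [average_sqrt_le_sqrt_average]
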